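/- Let $p$ be a prime, let $N \ge 0$, and consider commutative rings equipped with $N$ commuting derivations $\partial_1,\dots,\partial_N$ (differential rings). For a differential ring $R$, a differential polynomial in $x_1,\dots,x_m$ over $R$ is a polynomial over $R$ in the variables $\partial_1^{e_1}\cdots\partial_N^{e_N}x_j$ ($e_i\in\mathbb N$, $1\le j\le m$). A differential field $K$ is called differentially closed if every finite system of equations $p_1=\dots=p_s=0$ and inequations $q_1\ne 0,\dots,q_t\neq 0$, with $p_i,q_j$ differential polynomials in $x_1,\dots,x_m$ over $K$, that has a solution in some differential field extension of $K$ already has a solution in $K^m$. Let $K$ be a differentially closed field of characteristic $p$ with $N$ commuting derivations. Let $S$ be a differential $K$-algebra without zero divisors (a differential ring with a $K$-algebra structure whose structure map $K\to S$ commutes with the derivations), finitely generated as a differential $K$-algebra, that is, there is a finite subset of $S$ such that the only $K$-subalgebra of $S$ that contains it and is stable under $\partial_1,\dots,\partial_N$ is $S$ itself. Let $b$ be a nonzero element of $S$. Then there is a $K$-algebra homomorphism $\psi : S\to K$ that commutes with $\partial_1,\dots,\partial_N$ and satisfies $\psi(b)\ne 0$. -/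

import Mathlib

universe u v

namespace DeltaAlg

/-- A differential ring: a commutative ring with `N` commuting derivations. -/
class DeltaRing (N : ℕ) (R : Type*) [CommRing R] where
  /-- The derivations. -/
  der : Fin N → Derivation ℤ R R
  der_comm : ∀ (i j : Fin N) (r : R), der i (der j r) = der j (der i r)

/-- A differential algebra: the structure map commutes with the derivations. -/
class DeltaAlgebra (N : ℕ) (R S : Type*) [CommRing R] [CommRing S] [DeltaRing N R]
    [DeltaRing N S] [Algebra R S] : Prop where
  der_algebraMap : ∀ (i : Fin N) (r : R),
    DeltaRing.der i (algebraMap R S r) = algebraMap R S (DeltaRing.der i r)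

/-- The operator `∂₁^{e₁} ⋯ ∂_N^{e_N}` on a differential ring. -/
def theta {N : ℕ} {R : Type*} [CommRing R] [DeltaRing N R] (e : Fin N → ℕ) (r : R) : R :=
  (List.finRange N).foldr (fun i s => (DeltaRing.der i : Derivation ℤ R R)^[e i] s) r

/-- The ring `R{x₁, …, x_m}` of differential polynomials: polynomials over `R` in the
differential variables `θ x_j`, where the pair `(j, e)` stands for
`∂₁^{e₁} ⋯ ∂_N^{e_N} x_j`. -/
abbrev DeltaPoly (N m : ℕ) (R : Type*) [CommRing R] : Type _ :=
  MvPolynomial (Fin m × (Fin N → ℕ)) R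

/-- The value of a differential polynomial over `R` at an `m`-tuple `a` in `S`: the
variable `θ x_j` is replaced by `θ a_j`. -/
noncomputable def DeltaPoly.evalAt {N m : ℕ} {R S : Type*} [CommRing R] [CommRing S]
    [DeltaRing N S] [Algebra R S] (a : Fin m → S) (f : DeltaPoly N m R) : S :=
  MvPolynomial.aeval (fun w : Fin m × (Fin N → ℕ) => theta w.2 (a w.1)) f

/-- `K` is differentially closed: every finite system of differential polynomial equations
and inequations over `K` that has a solution in some differential field extension of `K`
has a solution in `K`. Extensions `L` in the universe of `K` suffice, because one may pass
to the differential subfield generated over `K` by a solution. -/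
def IsDeltaClosed (N : ℕ) (K : Type u) [Field K] [DeltaRing N K] : Prop :=
  ∀ (m : ℕ) (P Q : Finset (DeltaPoly N m K)),
    (∃ (L : Type u) (_ : Field L) (_ : DeltaRing N L) (_ : Algebra K L)
        (_ : DeltaAlgebra N K L) (a : Fin m → L),
        (∀ f ∈ P, f.evalAt a = 0) ∧ ∀ g ∈ Q, g.evalAt a ≠ 0) →
      ∃ a : Fin m → K, (∀ f ∈ P, f.evalAt a = 0) ∧ ∀ g ∈ Q, g.evalAt a ≠ 0

/-- `S` is finitely generated as a differential `R`-algebra: some finite subset of `S` is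
contained in no proper `R`-subalgebra that is stable under the derivations. -/
def IsDeltaFG (N : ℕ) (R S : Type*) [CommRing R] [CommRing S] [DeltaRing N S]
    [Algebra R S] : Prop :=
  ∃ A : Finset S, ∀ T : Subalgebra R S,
    (A : Set S) ⊆ T → (∀ (i : Fin N), ∀ s ∈ T, DeltaRing.der i s ∈ T) → T = ⊤

end DeltaAlg

namespace DeltaAlg

/-! ### Derivations as ring maps to dual numbers, so that universal properties extend them. -/

open MvPolynomial

/-! A homomorphism to K is a tuple c in K that satisfies every differential relation over K of a
generating tuple a of S. Differential closedness only solves finite systems, so the point is that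
all relations of a follow from finitely many equations and one inequation (`exists_finite_system`);
the condition on b is one more inequation.

Work in the fraction field L of S and rank the derivatives of a. Call a derivative parametric if it
is not in the field generated over K by the constants of L and the derivatives of lower rank. The
parametric derivatives are algebraically independent over K
(`algebraicIndependent_of_notMem_adjoin`): all p-th powers in L are constants, so a parametric
derivative has degree p over that field, and this forces all partial derivatives of a minimal
relation to vanish. After normalization its coefficients are constants of K, which are p-th powers
(`IsDeltaClosed.exists_pow_eq`), so the relation is a p-th power, against minimality.

By Dickson's lemma every other derivative is a derivative of one of finitely many, and these are
rational in finitely many constants Γ and parametric derivatives of lower rank. Adjoin Γ as new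
indeterminates with zero derivatives. Differentiating the resulting relations, linear in their
leaders, reduces any differential polynomial, up to a power of the product h of the leading
coefficients, to a polynomial in Γ and the parametric derivatives (`saturation_eq_top`). Relations
among those are finitely generated (`exists_finset_relations`). -/

/-- The derivation attached to a section of the dual numbers. -/
def derivationOfDual {R : Type*} [CommRing R] (f : R →+* DualNumber R)
    (hf : ∀ r, (f r).fst = r) : Derivation ℤ R R :=
  Derivation.mk' (AddMonoidHom.toIntLinearMap
    { toFun := fun r => (f r).snd
      map_zero' := by simp
      map_add' := by simp }) (by
    intro a b
    simp [hf, mul_comm])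

/-- The map to dual numbers attached to a ring homomorphism and a derivation of its source. -/
def dualOfHom {A B : Type*} [CommRing A] [CommRing B] (g : A →+* B) (D : Derivation ℤ A A) :
    A →+* DualNumber B where
  toFun r := (TrivSqZeroExt.inl (g r) + TrivSqZeroExt.inr (g (D r)) : DualNumber B)
  map_zero' := by simp
  map_one' := by simp
  map_add' a b := by ext <;> simp
  map_mul' a b := by ext <;> simp [mul_comm]

@[simp]
lemma fst_dualOfHom {A B : Type*} [CommRing A] [CommRing B] (g : A →+* B)
    (D : Derivation ℤ A A) (r : A) : (dualOfHom g D r).fst = g r := by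
  simp [dualOfHom]

@[simp]
lemma snd_dualOfHom {A B : Type*} [CommRing A] [CommRing B] (g : A →+* B)
    (D : Derivation ℤ A A) (r : A) : (dualOfHom g D r).snd = g (D r) := by
  simp [dualOfHom]

/-! ### The operators `theta` -/

section Theta

variable {N : ℕ} {R : Type*} [CommRing R] [DeltaRing N R]

lemma foldr_congr (e e' : Fin N → ℕ) (l : List (Fin N)) (h : ∀ i ∈ l, e i = e' i) (r : R) :
    l.foldr (fun i s => (DeltaRing.der i : Derivation ℤ R R)^[e i] s) r =
      l.foldr (fun i s => (DeltaRing.der i : Derivation ℤ R R)^[e' i] s) r := by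
  induction l with
  | nil => rfl
  | cons j l ih =>
    simp only [List.foldr_cons]
    rw [ih fun i hi => h i (List.mem_cons_of_mem _ hi), h j List.mem_cons_self]

/-- The derivations are applied in a fixed order; commutativity moves the extra one outwards past
those applied after it. -/
lemma foldr_add_single (e : Fin N → ℕ) (i : Fin N) (l : List (Fin N)) (hl : l.Nodup)
    (hi : i ∈ l) (r : R) :
    l.foldr (fun j s => (DeltaRing.der j : Derivation ℤ R R)^[(e + Pi.single i 1 : Fin N → ℕ) j] s) r =
      DeltaRing.der i (l.foldr (fun j s => (DeltaRing.der j : Derivation ℤ R R)^[e j] s) r) := by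
  induction l with
  | nil => simp at hi
  | cons j l ih =>
    simp only [List.foldr_cons]
    rw [List.nodup_cons] at hl
    by_cases hij : i = j
    · subst hij
      rw [foldr_congr (e + Pi.single i 1) e l]
      · simp [Function.iterate_succ_apply']
      · intro k hk
        have : k ≠ i := fun h => hl.1 (h ▸ hk)
        simp [this]
    · rw [ih hl.2 (by simpa [hij] using hi)]
      have hji : j ≠ i := fun h => hij h.symm
      simp only [Pi.add_apply, Pi.single_eq_of_ne hji, add_zero]
      exact (Function.Commute.iterate_right
        (f := (DeltaRing.der i : Derivation ℤ R R)) (g := (DeltaRing.der j : Derivation ℤ R R))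
        (fun r => DeltaRing.der_comm i j r) (e j) _).symm

lemma theta_add_single (e : Fin N → ℕ) (i : Fin N) (r : R) :
    theta (e + Pi.single i 1) r = DeltaRing.der i (theta e r) :=
  foldr_add_single e i _ (List.nodup_finRange N) (List.mem_finRange i) r

@[simp]
lemma theta_zero (r : R) : theta (0 : Fin N → ℕ) r = r := by
  unfold theta
  induction List.finRange N with
  | nil => rfl
  | cons j l ih => simp

/-- Induction on exponent vectors by adding unit vectors. -/
lemma exponent_induction {P : (Fin N → ℕ) → Prop} (zero : P 0)
    (add : ∀ e i, P e → P (e + Pi.single i 1)) (e : Fin N → ℕ) : P e := by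
  induction hn : ∑ i, e i generalizing e with
  | zero =>
    have : e = 0 := by
      funext i
      simpa using (Finset.sum_eq_zero_iff.mp hn) i (Finset.mem_univ i)
    exact this ▸ zero
  | succ n ih =>
    obtain ⟨i, hi⟩ : ∃ i, e i ≠ 0 := by
      by_contra! h
      simp [h] at hn
    have he : e = (e - Pi.single i 1) + Pi.single i 1 := by
      funext j
      by_cases hj : j = i
      · subst hj
        simp
        omega
      · simp [hj]
    rw [he]
    apply add
    apply ih
    rw [he] at hn
    simp only [Pi.add_apply, Finset.sum_add_distrib, Finset.sum_pi_single', Finset.mem_univ,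
      if_true] at hn
    simpa using hn

lemma theta_of_forall_der_eq_zero {r : R} (hr : ∀ i : Fin N, DeltaRing.der i r = 0)
    {e : Fin N → ℕ} (he : e ≠ 0) : theta e r = 0 := by
  revert he
  induction e using exponent_induction with
  | zero => simp
  | add e i ih =>
    intro _
    rw [theta_add_single]
    by_cases he : e = 0
    · simp [he, hr]
    · simp [ih he]

end Theta

/-! ### The differential ring of differential polynomials -/

section Eval

variable {N : ℕ} {ι K S : Type*} [CommRing K] [CommRing S] [DeltaRing N S] [Algebra K S]

/-- Evaluation of differential polynomials with an arbitrary index type at `y`. -/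
noncomputable def deltaEval (N : ℕ) (K : Type*) {S : Type*} [CommRing K] [CommRing S]
    [DeltaRing N S] [Algebra K S] (y : ι → S) : MvPolynomial (ι × (Fin N → ℕ)) K →ₐ[K] S :=
  MvPolynomial.aeval fun w => theta w.2 (y w.1)

@[simp]
lemma deltaEval_X (y : ι → S) (w : ι × (Fin N → ℕ)) :
    deltaEval N K y (X w) = theta w.2 (y w.1) := by
  simp [deltaEval]

variable [DeltaRing N K]

/-- The lift to dual numbers of the derivation `∂ᵢ` of the ring of differential polynomials. -/
noncomputable def polyDual (i : Fin N) : MvPolynomial (ι × (Fin N → ℕ)) K →+*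
    DualNumber (MvPolynomial (ι × (Fin N → ℕ)) K) :=
  eval₂Hom (dualOfHom MvPolynomial.C (DeltaRing.der i)) fun w =>
    (TrivSqZeroExt.inl (X w) + TrivSqZeroExt.inr (X (w.1, w.2 + Pi.single i 1)) :
      DualNumber (MvPolynomial (ι × (Fin N → ℕ)) K))

lemma fst_polyDual (i : Fin N) (f : MvPolynomial (ι × (Fin N → ℕ)) K) :
    (polyDual i f).fst = f := by
  induction f using MvPolynomial.induction_on with
  | C a => simp [polyDual]
  | add f g hf hg => simp [hf, hg]
  | mul_X f w hf => simp [hf]; simp [polyDual]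

/-- The derivation `∂ᵢ` of the ring of differential polynomials. -/
noncomputable def polyDer (i : Fin N) :
    Derivation ℤ (MvPolynomial (ι × (Fin N → ℕ)) K) (MvPolynomial (ι × (Fin N → ℕ)) K) :=
  derivationOfDual (polyDual i) (fst_polyDual i)

@[simp]
lemma polyDer_C (i : Fin N) (c : K) :
    polyDer i (C c : MvPolynomial (ι × (Fin N → ℕ)) K) = C (DeltaRing.der i c) := by
  change (polyDual i (C c)).snd = _
  simp [polyDual]

@[simp]
lemma polyDer_X (i : Fin N) (w : ι × (Fin N → ℕ)) :
    polyDer i (X w : MvPolynomial (ι × (Fin N → ℕ)) K) = X (w.1, w.2 + Pi.single i 1) := by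
  change (polyDual i (X w)).snd = _
  simp [polyDual]

lemma deltaEval_polyDer [DeltaAlgebra N K S] (y : ι → S) (i : Fin N)
    (f : MvPolynomial (ι × (Fin N → ℕ)) K) :
    deltaEval N K y (polyDer i f) = DeltaRing.der i (deltaEval N K y f) := by
  induction f using MvPolynomial.induction_on with
  | C a =>
    rw [polyDer_C, ← MvPolynomial.algebraMap_eq, AlgHom.commutes, AlgHom.commutes,
      DeltaAlgebra.der_algebraMap]
  | add f g hf hg => simp [hf, hg]
  | mul_X f w hf => simp [hf, theta_add_single]

/-- The derivation `∂ᵢ` preserves polynomials in a set of variables mapped by `∂ᵢ` into a larger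
set. -/
lemma polyDer_mem_supported (i : Fin N) {s t : Set (ι × (Fin N → ℕ))} (hst : s ⊆ t)
    (h : ∀ w ∈ s, (w.1, w.2 + Pi.single i 1) ∈ t) {f : MvPolynomial (ι × (Fin N → ℕ)) K}
    (hf : f ∈ supported K s) : polyDer i f ∈ supported K t := by
  have hle := supported_mono (R := K) hst
  rw [supported_eq_adjoin_X] at hf
  induction hf using Algebra.adjoin_induction with
  | mem x hx =>
    obtain ⟨w, hw, rfl⟩ := hx
    rw [polyDer_X, supported_eq_adjoin_X]
    exact Algebra.subset_adjoin ⟨_, h w hw, rfl⟩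
  | algebraMap r =>
    rw [MvPolynomial.algebraMap_eq, polyDer_C, ← MvPolynomial.algebraMap_eq]
    exact Subalgebra.algebraMap_mem _ _
  | add x y _ _ hx hy => rw [map_add]; exact add_mem hx hy
  | mul x y hx' hy' hx hy =>
    rw [Derivation.leibniz, smul_eq_mul, smul_eq_mul]
    exact add_mem (mul_mem (hle hx') hy) (mul_mem (hle hy') hx)

end Eval

/-! ### Differential structures on isomorphic rings and fraction fields -/

section Constructions

variable {N : ℕ}

/-- Transport of a differential structure along a ring isomorphism. -/
@[reducible]
def DeltaRing.ofEquiv {A S : Type*} [CommRing A] [CommRing S] [DeltaRing N S] (e : A ≃+* S) :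
    DeltaRing N A where
  der i := Derivation.mk' (AddMonoidHom.toIntLinearMap
    (e.symm.toAddMonoidHom.comp
      ((DeltaRing.der i : Derivation ℤ S S).toLinearMap.toAddMonoidHom.comp e.toAddMonoidHom)))
    (by intro a b; simp)
  der_comm i j r := by
    simp [DeltaRing.der_comm i j]

section FractionField

variable {S L : Type*} [CommRing S] [IsDomain S] [Field L] [Algebra S L] [IsFractionRing S L]

/-- The lift to dual numbers of the extension of a derivation of a domain to its fraction
field. -/
noncomputable def fractionDual (L : Type*) [Field L] [Algebra S L] [IsFractionRing S L]
    (D : Derivation ℤ S S) : L →+* DualNumber L :=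
  IsLocalization.lift (M := nonZeroDivisors S) (g := dualOfHom (algebraMap S L) D)
    (by
      intro y
      rw [TrivSqZeroExt.isUnit_iff_isUnit_fst, fst_dualOfHom]
      exact IsLocalization.map_units _ y)

omit [IsDomain S] in
lemma fst_fractionDual (D : Derivation ℤ S S) (x : L) : (fractionDual L D x).fst = x := by
  have h : (TrivSqZeroExt.fstHom ℤ L L).toRingHom.comp (fractionDual L D) = RingHom.id _ := by
    apply IsLocalization.ringHom_ext (nonZeroDivisors S)
    ext x
    simp [fractionDual]
  exact RingHom.congr_fun h x

/-- The derivation of the fraction field extending a derivation of a domain. -/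
noncomputable def fractionDer (L : Type*) [Field L] [Algebra S L] [IsFractionRing S L]
    (D : Derivation ℤ S S) : Derivation ℤ L L :=
  derivationOfDual (fractionDual L D) (fst_fractionDual D)

omit [IsDomain S] in
lemma fractionDer_algebraMap (D : Derivation ℤ S S) (x : S) :
    fractionDer L D (algebraMap S L x) = algebraMap S L (D x) := by
  change (fractionDual L D (algebraMap S L x)).snd = _
  simp [fractionDual]

/-- Apply Leibniz to a = (a/b)·b. Used for the commutator of two extended derivations. -/
lemma derivation_eq_zero_of_algebraMap (S : Type*) [CommRing S] [IsDomain S] [Algebra S L]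
    [IsFractionRing S L] (D : Derivation ℤ L L) (h : ∀ x : S, D (algebraMap S L x) = 0) (x : L) :
    D x = 0 := by
  obtain ⟨a, b, hb, rfl⟩ := IsFractionRing.div_surjective (A := S) x
  have hb0 : algebraMap S L b ≠ 0 := IsFractionRing.to_map_ne_zero_of_mem_nonZeroDivisors hb
  have := h a
  rw [← div_mul_cancel₀ (algebraMap S L a) hb0, Derivation.leibniz, h b] at this
  simpa [hb0] using this

lemma fractionDer_comm (D D' : Derivation ℤ S S) (h : ∀ x, D (D' x) = D' (D x)) (x : L) :
    fractionDer L D (fractionDer L D' x) = fractionDer L D' (fractionDer L D x) := by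
  have := derivation_eq_zero_of_algebraMap S ⁅fractionDer L D, fractionDer L D'⁆ (by
    intro x
    rw [Derivation.commutator_apply]
    simp only [fractionDer_algebraMap, h, sub_self]) x
  rwa [Derivation.commutator_apply, sub_eq_zero] at this

/-- The differential structure of the fraction field of a differential domain. -/
@[reducible]
noncomputable def fractionDelta (N : ℕ) (S L : Type*) [CommRing S] [IsDomain S] [Field L]
    [Algebra S L] [IsFractionRing S L] [DeltaRing N S] : DeltaRing N L where
  der i := fractionDer L (DeltaRing.der i : Derivation ℤ S S)
  der_comm i j := fractionDer_comm _ _ (DeltaRing.der_comm i j)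

lemma deltaAlgebra_fraction {K : Type*} [CommRing K] [Algebra K S] [Algebra K L]
    [IsScalarTower K S L] [DeltaRing N K] [DeltaRing N S] [DeltaAlgebra N K S] :
    letI := fractionDelta N S L
    DeltaAlgebra N K L :=
  letI := fractionDelta N S L
  { der_algebraMap := fun i r => by
      rw [IsScalarTower.algebraMap_apply K S L, IsScalarTower.algebraMap_apply K S L,
        ← DeltaAlgebra.der_algebraMap]
      exact fractionDer_algebraMap _ _ }

end FractionField

end Constructions

/-! ### Constants of a differentially closed field are p-th powers -/

section PthRoot

variable {N p : ℕ} {K : Type u} [Field K] [DeltaRing N K]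

/-- The lift to dual numbers of the derivation of `K[X]/(X ^ p - c)` for which the root of
`X ^ p - c` is constant. -/
noncomputable def rootDual (D : Derivation ℤ K K) {c : K} (hc : D c = 0) (p : ℕ) :
    AdjoinRoot (Polynomial.X ^ p - Polynomial.C c) →+*
      DualNumber (AdjoinRoot (Polynomial.X ^ p - Polynomial.C c)) :=
  AdjoinRoot.lift (dualOfHom (AdjoinRoot.of _) D)
    (TrivSqZeroExt.inl (AdjoinRoot.root (Polynomial.X ^ p - Polynomial.C c)) :
      DualNumber (AdjoinRoot (Polynomial.X ^ p - Polynomial.C c))) (by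
    have h : (AdjoinRoot.root (Polynomial.X ^ p - Polynomial.C c)) ^ p = AdjoinRoot.of _ c := by
      have := AdjoinRoot.eval₂_root (Polynomial.X ^ p - Polynomial.C c)
      simpa [sub_eq_zero] using this
    simp only [Polynomial.eval₂_sub, Polynomial.eval₂_pow, Polynomial.eval₂_X, Polynomial.eval₂_C]
    rw [sub_eq_zero]
    refine (TrivSqZeroExt.inl_pow _ _).trans ?_
    rw [h]
    ext <;> simp [hc])

lemma fst_rootDual (D : Derivation ℤ K K) {c : K} (hc : D c = 0) (p : ℕ)
    (x : AdjoinRoot (Polynomial.X ^ p - Polynomial.C c)) : (rootDual D hc p x).fst = x := by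
  have h : (TrivSqZeroExt.fstHom ℤ _ _).toRingHom.comp (rootDual D hc p) = RingHom.id _ := by
    apply AdjoinRoot.ringHom_ext
    · ext x
      simp [rootDual]
    · simp [rootDual]
  exact RingHom.congr_fun h x

/-- The derivation of `K[X]/(X ^ p - c)` for which the root of `X ^ p - c` is constant. -/
noncomputable def rootDer (D : Derivation ℤ K K) {c : K} (hc : D c = 0) (p : ℕ) :
    Derivation ℤ (AdjoinRoot (Polynomial.X ^ p - Polynomial.C c))
      (AdjoinRoot (Polynomial.X ^ p - Polynomial.C c)) :=
  derivationOfDual (rootDual D hc p) (fst_rootDual D hc p)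

lemma rootDer_of (D : Derivation ℤ K K) {c : K} (hc : D c = 0) (p : ℕ) (x : K) :
    rootDer D hc p (AdjoinRoot.of _ x) = AdjoinRoot.of _ (D x) := by
  change (rootDual D hc p (AdjoinRoot.of _ x)).snd = _
  simp [rootDual]

lemma rootDer_root (D : Derivation ℤ K K) {c : K} (hc : D c = 0) (p : ℕ) :
    rootDer D hc p (AdjoinRoot.root _) = 0 := by
  change (rootDual D hc p (AdjoinRoot.root _)).snd = _
  simp [rootDual]

/-- The differential structure of `K[X]/(X ^ p - c)` for which the root of `X ^ p - c` is
constant. -/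
@[reducible]
noncomputable def rootDelta {c : K} (hc : ∀ i : Fin N, DeltaRing.der i c = 0) (p : ℕ) :
    DeltaRing N (AdjoinRoot (Polynomial.X ^ p - Polynomial.C c)) where
  der i := rootDer (DeltaRing.der i) (hc i) p
  der_comm i j r := by
    -- The commutator is again a derivation, so it vanishes once it kills K and the root.
    set D := ⁅rootDer (DeltaRing.der i : Derivation ℤ K K) (hc i) p,
      rootDer (DeltaRing.der j : Derivation ℤ K K) (hc j) p⁆ with hD
    have h : D r = 0 := by
      have h1 : ∀ x, D (AdjoinRoot.of _ x) = 0 := by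
        intro x
        rw [hD, Derivation.commutator_apply]
        simp only [rootDer_of, DeltaRing.der_comm i j, sub_self]
      have h2 : D (AdjoinRoot.root _) = 0 := by
        rw [hD, Derivation.commutator_apply, rootDer_root, rootDer_root, map_zero, map_zero,
          sub_self]
      induction r using AdjoinRoot.induction_on with
      | ih f =>
        induction f using Polynomial.induction_on with
        | C a => simpa using h1 a
        | add f g hf hg => simp [hf, hg]
        | monomial n a _ => simp [h1, h2]
    rwa [hD, Derivation.commutator_apply, sub_eq_zero] at h

/-- The constants of a differentially closed field are `p`-th powers. -/
theorem IsDeltaClosed.exists_pow_eq (hK : IsDeltaClosed N K) (hp : p.Prime) {c : K}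
    (hc : ∀ i : Fin N, DeltaRing.der i c = 0) : ∃ d : K, d ^ p = c := by
  -- Without a p-th root of c in K, adjoining one as a constant gives a differential field extension
  -- that solves x ^ p = c.
  by_contra! hcp
  have hirr := X_pow_sub_C_irreducible_of_prime hp hcp
  have : Fact (Irreducible (Polynomial.X ^ p - Polynomial.C c)) := ⟨hirr⟩
  let := rootDelta hc p
  have : DeltaAlgebra N K (AdjoinRoot (Polynomial.X ^ p - Polynomial.C c)) :=
    ⟨fun i r => rootDer_of _ (hc i) p r⟩
  have hroot : (AdjoinRoot.root (Polynomial.X ^ p - Polynomial.C c)) ^ p =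
      algebraMap K _ c := by
    have := AdjoinRoot.eval₂_root (Polynomial.X ^ p - Polynomial.C c)
    simpa [sub_eq_zero] using this
  obtain ⟨a, ha, -⟩ := hK 1 {X (0, 0) ^ p - C c} ∅
    ⟨AdjoinRoot (Polynomial.X ^ p - Polynomial.C c), inferInstance, inferInstance, inferInstance,
      inferInstance, fun _ => AdjoinRoot.root _, by
        simp [DeltaPoly.evalAt, hroot], by simp⟩
  have := ha _ (Finset.mem_singleton_self _)
  simp only [DeltaPoly.evalAt, map_sub, map_pow, aeval_X, theta_zero, aeval_C,
    Algebra.algebraMap_self, RingHom.id_apply, sub_eq_zero] at this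
  exact hcp _ this

end PthRoot


/-! ### Algebraic independence over the constants in characteristic p -/

/-- The constants of a differential ring. -/
def constants (N : ℕ) (L : Type*) [CommRing L] [DeltaRing N L] : Set L :=
  {x | ∀ i : Fin N, DeltaRing.der i x = 0}

lemma pow_mem_constants {N : ℕ} {L : Type*} [CommRing L] [DeltaRing N L] (p : ℕ) [CharP L p]
    (x : L) : x ^ p ∈ constants N L := by
  intro i
  simp [Derivation.leibniz_pow]

section

variable {σ K L : Type*} [Field K] [Field L] [Algebra K L]

lemma derivative_aeval_update [DecidableEq σ] (x : σ → L) (u : σ) (f : MvPolynomial σ K) :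
    Polynomial.derivative (aeval (fun w => if w = u then Polynomial.X else Polynomial.C (x w)) f) =
      aeval (fun w => if w = u then Polynomial.X else Polynomial.C (x w)) (pderiv u f) := by
  induction f using MvPolynomial.induction_on with
  | C a => simp
  | add f g hf hg => simp [hf, hg]
  | mul_X f w hf =>
    by_cases hw : w = u
    · subst hw
      simp [hf]; ring
    · simp [hf, hw, pderiv_X_of_ne hw, mul_comm]

lemma eval_aeval_update [DecidableEq σ] (x : σ → L) (u : σ) (f : MvPolynomial σ K) :
    (aeval (fun w => if w = u then Polynomial.X else Polynomial.C (x w)) f :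
      Polynomial L).eval (x u) = aeval x f := by
  induction f using MvPolynomial.induction_on with
  | C a => simp
  | add f g hf hg => simp [hf, hg]
  | mul_X f w hf =>
    by_cases hw : w = u
    · subst hw
      simp [hf]
    · simp [hf, hw]

/-- Differentiation multiplies the nonzero coefficient at e by e u, which must therefore vanish in
K. -/
lemma exists_eq_of_pderiv_eq_zero (p : ℕ) [CharP K p] {f : MvPolynomial σ K} {u : σ}
    (h : pderiv u f = 0) {e : σ →₀ ℕ} (he : e ∈ f.support) : p ∣ e u := by
  by_cases h0 : e u = 0
  · simp [h0]
  have := congrArg (coeff (e - Finsupp.single u 1)) h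
  have he' : e - Finsupp.single u 1 + Finsupp.single u 1 = e := by
    apply tsub_add_cancel_of_le
    rw [Finsupp.single_le_iff]
    omega
  rw [coeff_pderiv, he', coeff_zero, mul_eq_zero] at this
  rcases this with h1 | h1
  · exact absurd h1 (mem_support_iff.mp he)
  · rw [← CharP.cast_eq_zero_iff K p]
    have : (e - Finsupp.single u 1 : σ →₀ ℕ) u + 1 = e u := by
      simp; omega
    rw [← this]
    exact_mod_cast h1

/-- If `x u` generates a purely inseparable extension of degree `p` of a field containing `x w`
for smaller `w`, a polynomial relation separable at most in `u` and smaller variables may be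
differentiated with respect to `u`. -/
lemma aeval_pderiv_eq_zero {p : ℕ} (hp : p.Prime) [CharP K p] [CharP L p] (x : σ → L) (u : σ)
    (F : IntermediateField K L) (hF : ∀ y : L, y ^ p ∈ F) (hu : x u ∉ F)
    (f : MvPolynomial σ K) (hf : ∀ w, w ≠ u → x w ∈ F ∨ pderiv w f = 0) (h0 : aeval x f = 0) :
    aeval x (pderiv u f) = 0 := by
  classical
  set g : Polynomial L :=
    aeval (fun w => if w = u then Polynomial.X else Polynomial.C (x w)) f with hg
  -- The coefficients of g lie in F: a variable other than u has its value in F, or occurs only with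
  -- exponents divisible by p.
  have hlift : g ∈ Polynomial.lifts (algebraMap F L) := by
    rw [hg, f.as_sum, map_sum]
    refine Subsemiring.sum_mem _ fun e he => ?_
    rw [aeval_monomial]
    refine mul_mem ?_ (Subsemiring.prod_mem _ fun w hw => ?_)
    · exact (Polynomial.mem_lifts _).mpr ⟨Polynomial.C (algebraMap K F (coeff e f)), by
        simp [← IsScalarTower.algebraMap_apply, Polynomial.algebraMap_apply]⟩
    · dsimp only
      by_cases hwu : w = u
      · rw [if_pos hwu]
        exact pow_mem ((Polynomial.mem_lifts _).mpr ⟨Polynomial.X, by simp⟩) _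
      · rw [if_neg hwu]
        rcases hf w hwu with h | h
        · exact pow_mem ((Polynomial.mem_lifts _).mpr ⟨Polynomial.C ⟨_, h⟩, by
            rw [Polynomial.map_C]; rfl⟩) _
        · obtain ⟨k, hk⟩ := exists_eq_of_pderiv_eq_zero p h he
          rw [hk, pow_mul, ← Polynomial.C_pow]
          exact pow_mem ((Polynomial.mem_lifts _).mpr ⟨Polynomial.C ⟨_, hF (x w)⟩, by
            rw [Polynomial.map_C]; rfl⟩) _
  obtain ⟨q, hq⟩ := (Polynomial.mem_lifts _).mp hlift
  -- This is the minimal polynomial of x u over F: by injectivity of Frobenius, a p-th root in F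
  -- would equal x u.
  have hirr : Irreducible (Polynomial.X ^ p - Polynomial.C (⟨_, hF (x u)⟩ : F)) := by
    apply X_pow_sub_C_irreducible_of_prime hp
    intro b hb
    apply hu
    have hb' : (b : L) ^ p = x u ^ p := congrArg Subtype.val hb
    have : Fact p.Prime := ⟨hp⟩
    rw [← frobenius_inj L p hb']
    exact b.2
  have hdvd : (Polynomial.X ^ p - Polynomial.C (⟨_, hF (x u)⟩ : F)) ∣ q := by
    rw [minpoly.eq_of_irreducible_of_monic hirr (x := x u) (by simp [IntermediateField.algebraMap_apply])
      (Polynomial.monic_X_pow_sub_C _ hp.ne_zero)]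
    apply minpoly.dvd
    rw [Polynomial.aeval_def, ← Polynomial.eval_map, hq, hg, eval_aeval_update, h0]
  obtain ⟨r, rfl⟩ := hdvd
  -- The derivative of (X ^ p - c) r is (X ^ p - c) r' in characteristic p, which still vanishes at
  -- x u.
  rw [← eval_aeval_update x u, ← derivative_aeval_update, ← hg, ← hq, Polynomial.derivative_map,
    Polynomial.eval_map, Polynomial.derivative_mul]
  have : CharP F p := charP_of_injective_algebraMap (algebraMap K F).injective p
  simp [IntermediateField.algebraMap_apply, Polynomial.derivative_X_pow]

variable {N : ℕ} [DeltaRing N K] [DeltaRing N L] [DeltaAlgebra N K L]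

/-- The values of the monomials are p-th powers, hence constants, so differentiating the relation
affects only its coefficients. -/
lemma aeval_sum_der_eq_zero {p : ℕ} [CharP L p] (x : σ → L) (f : MvPolynomial σ K)
    (hf : ∀ e ∈ f.support, ∀ w, p ∣ e w) (h0 : aeval x f = 0) (i : Fin N) :
    aeval x (∑ e ∈ f.support, monomial e (DeltaRing.der i (coeff e f))) = 0 := by
  have h := congrArg (DeltaRing.der i) h0
  rw [map_zero, f.as_sum, map_sum, map_sum] at h
  rw [map_sum, ← h]
  refine Finset.sum_congr rfl fun e he => ?_
  have hc : DeltaRing.der i (e.prod fun w k => x w ^ k) = 0 := by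
    have : (e.prod fun w k => x w ^ k) = (e.prod fun w k => x w ^ (k / p)) ^ p := by
      rw [Finsupp.prod, Finsupp.prod, ← Finset.prod_pow]
      refine Finset.prod_congr rfl fun w _ => ?_
      rw [← pow_mul, Nat.div_mul_cancel (hf e he w)]
    rw [this]
    exact pow_mem_constants p _ i
  rw [aeval_monomial, aeval_monomial, Derivation.leibniz, hc, DeltaAlgebra.der_algebraMap]
  simp [mul_comm]

/-- Elements none of which lies in the field generated by the constants and the smaller ones are
algebraically independent, provided that the constants of the ground field are `p`-th powers. -/
theorem algebraicIndependent_of_notMem_adjoin {p : ℕ} (hp : p.Prime) [CharP K p] [CharP L p]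
    (hK : ∀ c ∈ constants N K, ∃ d, d ^ p = c) {O : Type*} [LinearOrder O] (rk : σ → O)
    (hrk : Function.Injective rk) (x : σ → L)
    (hx : ∀ u, x u ∉ IntermediateField.adjoin K (constants N L ∪ x '' {w | rk w < rk u})) :
    AlgebraicIndependent K x := by
  classical
  have : Fact p.Prime := ⟨hp⟩
  rw [algebraicIndependent_iff]
  -- Induction on the degree, then on the number of terms; the latter serves to make the
  -- coefficients constant.
  suffices H : ∀ (n m : ℕ) (f : MvPolynomial σ K), f.totalDegree = n → f.support.card = m →
      aeval x f = 0 → f = 0 from fun f hf => H _ _ f rfl rfl hf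
  intro n
  induction n using Nat.strong_induction_on with
  | _ n ihn =>
  intro m
  induction m using Nat.strong_induction_on with
  | _ m ihm =>
  intro f hn hm h0
  by_contra hf
  by_cases hn0 : n = 0
  · rw [hn0, totalDegree_eq_zero_iff_eq_C] at hn
    rw [hn, aeval_C, map_eq_zero] at h0
    rw [h0, map_zero] at hn
    exact hf hn
  have hpd : ∀ u, pderiv u f = 0 := by
    by_contra! hne
    -- At the highest u with nonzero partial derivative, differentiating gives a relation of smaller
    -- degree, which must be zero.
    set V := f.vars.filter fun u => pderiv u f ≠ 0 with hV
    have hVne : V.Nonempty := by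
      obtain ⟨u, hu⟩ := hne
      refine ⟨u, Finset.mem_filter.mpr ⟨?_, hu⟩⟩
      by_contra hmem
      exact hu (pderiv_eq_zero_of_notMem_vars hmem)
    obtain ⟨u, huV, hmax⟩ := V.exists_max_image rk hVne
    have hu := (Finset.mem_filter.mp huV).2
    apply hu
    apply ihn _ _ _ _ rfl rfl
    · apply aeval_pderiv_eq_zero hp x u _ _ (hx u) f _ h0
      · intro y
        exact IntermediateField.subset_adjoin _ _ (Or.inl (pow_mem_constants p y))
      · intro w hw
        by_cases hw0 : pderiv w f = 0
        · exact Or.inr hw0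
        left
        have hwV : w ∈ V := Finset.mem_filter.mpr ⟨by
          by_contra hmem
          exact hw0 (pderiv_eq_zero_of_notMem_vars hmem), hw0⟩
        have hlt : rk w < rk u := lt_of_le_of_ne (hmax w hwV) fun h => hw (hrk h)
        exact IntermediateField.subset_adjoin _ _ (Or.inr ⟨w, hlt, rfl⟩)
    · rw [totalDegree, Finset.sup_lt_iff (Nat.pos_of_ne_zero hn0)]
      intro d hd
      rw [mem_support_iff, coeff_pderiv] at hd
      have := le_totalDegree (mem_support_iff.mpr (left_ne_zero_of_mul hd))
      rw [hn, Finsupp.sum_add_index' (fun _ => rfl) (fun _ _ _ => rfl),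
        Finsupp.sum_single_index rfl] at this
      exact this
  have hdvd : ∀ e ∈ f.support, ∀ w, p ∣ e w := fun e he w =>
    exists_eq_of_pderiv_eq_zero p (hpd w) he
  obtain ⟨e₀, he₀⟩ := support_nonempty.mpr hf
  have hc₀ : coeff e₀ f ≠ 0 := mem_support_iff.mp he₀
  -- With one coefficient equal to 1, differentiating the coefficients removes a term.
  wlog h1 : coeff e₀ f = 1 generalizing f
  · have hsupp : (C (coeff e₀ f)⁻¹ * f).support = f.support := by
      ext e
      simp [mem_support_iff, coeff_C_mul, hc₀]
    refine this (C (coeff e₀ f)⁻¹ * f) ?_ ?_ ?_ ?_ ?_ ?_ ?_ ?_ ?_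
    · rw [← hn, totalDegree, totalDegree, hsupp]
    · rw [hsupp, hm]
    · simp [h0]
    · simp [hf, hc₀]
    · intro u
      simp [hpd u]
    · rwa [hsupp]
    · rwa [hsupp]
    · simp [coeff_C_mul, hc₀]
    · simp [coeff_C_mul, hc₀]
  have hconst : ∀ e ∈ f.support, coeff e f ∈ constants N K := by
    intro e he i
    set g := ∑ e ∈ f.support, monomial e (DeltaRing.der i (coeff e f)) with hg
    have hcoeff : ∀ e, coeff e g = DeltaRing.der i (coeff e f) := by
      intro e
      rw [hg, coeff_sum]
      simp only [coeff_monomial]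
      rw [Finset.sum_ite_eq']
      split_ifs with h
      · rfl
      · rw [notMem_support_iff.mp h, map_zero]
    have hsub : g.support ⊆ f.support.erase e₀ := by
      intro d hd
      rw [mem_support_iff, hcoeff] at hd
      rw [Finset.mem_erase, mem_support_iff]
      refine ⟨?_, fun h => hd (by rw [h, map_zero])⟩
      rintro rfl
      rw [h1] at hd
      simp at hd
    have hg0 : aeval x g = 0 := aeval_sum_der_eq_zero x f hdvd h0 i
    have hcard : g.support.card < m := by
      rw [← hm]
      exact (Finset.card_le_card hsub).trans_lt (Finset.card_erase_lt_of_mem he₀)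
    have hdeg : g.totalDegree ≤ n := by
      rw [← hn]
      exact Finset.sup_mono (hsub.trans (Finset.erase_subset _ _))
    have : g = 0 := by
      rcases hdeg.lt_or_eq with h | h
      · exact ihn _ h _ g rfl rfl hg0
      · exact ihm _ hcard g h rfl hg0
    rw [← hcoeff, this, coeff_zero]
  -- Exponents are divisible by p and coefficients are p-th powers, so f = g ^ p with g of smaller
  -- degree.
  choose! d hd using hK
  let g : MvPolynomial σ K :=
    ∑ e ∈ f.support, monomial (e.mapRange (· / p) (Nat.zero_div p)) (d (coeff e f))
  have hgp : g ^ p = f := by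
    rw [sum_pow_char]
    conv_rhs => rw [f.as_sum]
    refine Finset.sum_congr rfl fun e he => ?_
    rw [monomial_pow, hd _ (hconst e he)]
    refine congrArg (fun s => monomial s (coeff e f)) ?_
    ext w
    simp [Nat.mul_div_cancel' (hdvd e he w)]
  have hg0 : aeval x g = 0 := by
    rw [← hgp, map_pow] at h0
    exact pow_eq_zero_iff hp.ne_zero |>.mp h0
  have hdeg : g.totalDegree < n := by
    refine (totalDegree_finsetSum _ _).trans_lt ?_
    rw [Finset.sup_lt_iff (Nat.pos_of_ne_zero hn0)]
    intro e he
    refine (totalDegree_monomial_le _ _).trans_lt ?_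
    have hle := le_totalDegree he
    rw [hn] at hle
    have hmul : (e.sum fun _ k => k) =
        p * (e.mapRange (· / p) (Nat.zero_div p)).sum fun _ k => k := by
      rw [Finsupp.sum_mapRange_index (fun _ => rfl), Finsupp.sum, Finsupp.sum, Finset.mul_sum]
      exact Finset.sum_congr rfl fun w _ => (Nat.mul_div_cancel' (hdvd e he w)).symm
    rw [hmul] at hle
    have h2 := hp.two_le
    have hn1 := Nat.pos_of_ne_zero hn0
    change (e.mapRange (· / p) (Nat.zero_div p)).sum (fun _ k => k) < n
    nlinarith
  have := ihn _ hdeg _ g rfl rfl hg0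
  rw [this, zero_pow hp.ne_zero] at hgp
  exact hf hgp.symm

end


/-! ### Finite generation of relations over an independent family -/

section

variable {V K L : Type*} [Field K] [Field L] [Algebra K L]

/-- Independence has finite character: if v γ were transcendental over every finite part, γ could be
added to B. -/
lemma exists_finite_isAlgebraic_adjoin {v : V → L} {B : Set V} (hB : AlgebraicIndepOn K v B)
    {γ : V} (hγ : γ ∉ B) (halg : IsAlgebraic (Algebra.adjoin K (v '' B)) (v γ)) :
    ∃ s ⊆ B, s.Finite ∧ IsAlgebraic (Algebra.adjoin K (v '' s)) (v γ) := by
  by_contra! H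
  have hins : AlgebraicIndepOn K v (insert γ B) := by
    apply algebraicIndependent_of_finite_type
    intro t ht
    have hfin : (Subtype.val '' t ∩ B : Set V).Finite := (ht.image _).inter_of_left _
    have hs := AlgebraicIndepOn.insert (hB.mono Set.inter_subset_right)
      (H _ Set.inter_subset_right hfin)
    refine hs.comp (fun i : t => ⟨i.1.1, ?_⟩) ?_
    · rcases i.1.2 with h | h
      · exact Or.inl h
      · exact Or.inr ⟨⟨i.1, i.2, rfl⟩, h⟩
    · intro i j hij
      exact Subtype.ext (Subtype.ext (by simpa using hij))
  exact ((AlgebraicIndepOn.insert_iff hγ).mp hins).2 halg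

/-- A finite set of elements is algebraic over a finite part of a suitable algebraically
independent extension of a given algebraically independent family. -/
lemma exists_algebraicIndepOn_superset {v : V → L} {U : Set V} (hU : AlgebraicIndepOn K v U)
    (G : Finset V) : ∃ B : Set V, U ⊆ B ∧ AlgebraicIndepOn K v B ∧ ∃ s ⊆ B, s.Finite ∧
      ∀ γ ∈ G, IsAlgebraic (Algebra.adjoin K (v '' s)) (v γ) := by
  classical
  induction G using Finset.induction_on with
  | empty => exact ⟨U, subset_rfl, hU, ∅, Set.empty_subset _, Set.finite_empty, by simp⟩
  | insert γ G _ ih =>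
    obtain ⟨B, hUB, hB, s, hsB, hs, hG⟩ := ih
    have mono : ∀ {t t' : Set V} {x : L}, t ⊆ t' → IsAlgebraic (Algebra.adjoin K (v '' t)) x →
        IsAlgebraic (Algebra.adjoin K (v '' t')) x := by
      intro t t' x htt' hx
      exact hx.adjoin_of_forall_isAlgebraic fun y hy =>
        absurd (Set.image_mono htt' hy.1) hy.2
    have mem : ∀ {t : Set V} {w : V}, w ∈ t → IsAlgebraic (Algebra.adjoin K (v '' t)) (v w) :=
      fun {t w} hw => isAlgebraic_algebraMap
        (⟨v w, Algebra.subset_adjoin ⟨w, hw, rfl⟩⟩ : Algebra.adjoin K (v '' t))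
    by_cases hγ : γ ∈ B
    · refine ⟨B, hUB, hB, insert γ s, Set.insert_subset hγ hsB, hs.insert _, ?_⟩
      intro δ hδ
      rcases Finset.mem_insert.mp hδ with rfl | hδ
      · exact mem (Set.mem_insert _ _)
      · exact mono (Set.subset_insert _ _) (hG δ hδ)
    by_cases halg : IsAlgebraic (Algebra.adjoin K (v '' B)) (v γ)
    · obtain ⟨t, htB, ht, hta⟩ := exists_finite_isAlgebraic_adjoin hB hγ halg
      refine ⟨B, hUB, hB, s ∪ t, Set.union_subset hsB htB, hs.union ht, ?_⟩
      intro δ hδ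
      rcases Finset.mem_insert.mp hδ with rfl | hδ
      · exact mono Set.subset_union_right hta
      · exact mono Set.subset_union_left (hG δ hδ)
    · refine ⟨insert γ B, hUB.trans (Set.subset_insert _ _), hB.insert halg, insert γ s,
        Set.insert_subset_insert hsB, hs.insert _, ?_⟩
      intro δ hδ
      rcases Finset.mem_insert.mp hδ with rfl | hδ
      · exact mem (Set.mem_insert _ _)
      · exact mono (Set.subset_insert _ _) (hG δ hδ)

/-- The relations among finitely many elements and an algebraically independent family are
generated by finitely many of them. -/
theorem exists_finset_relations (v : V → L) {G U : Set V} (hG : G.Finite)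
    (hU : AlgebraicIndepOn K v U) :
    ∃ E : Finset (MvPolynomial V K), (∀ g ∈ E, aeval v g = 0) ∧
      ∀ f ∈ supported K (G ∪ U), aeval v f = 0 → f ∈ Ideal.span (E : Set (MvPolynomial V K)) := by
  classical
  obtain ⟨B, hUB, hB, s, hsB, hs, halg⟩ := exists_algebraicIndepOn_superset hU hG.toFinset
  let T : Set V := G ∪ s
  have hT : Finite T := (hG.union hs).to_subtype
  let ψ₀ : MvPolynomial T K →ₐ[K] L := aeval fun t => v t
  let R₀ := Algebra.adjoin K (v '' s)
  have hψ : ∀ a, ψ₀ a ∈ Subalgebra.algebraicClosure R₀ L := by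
    intro a
    induction a using MvPolynomial.induction_on with
    | C a =>
      rw [← MvPolynomial.algebraMap_eq, AlgHom.commutes]
      exact isAlgebraic_algebraMap (A := L) (algebraMap K R₀ a)
    | add f g hf hg => rw [map_add]; exact add_mem hf hg
    | mul_X f t hf =>
      rw [map_mul]
      refine mul_mem hf ?_
      rw [show ψ₀ (X t) = v t from aeval_X _ _]
      rcases t.2 with h | h
      · exact halg _ (hG.mem_toFinset.mpr h)
      · exact (isAlgebraic_algebraMap (⟨v t, Algebra.subset_adjoin ⟨t, h, rfl⟩⟩ : R₀) :
          IsAlgebraic R₀ (v t))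
  -- The values on T are algebraic over R₀, and B \ s stays independent over its algebraic closure.
  -- So a relation, read as a polynomial in B \ s, holds only if each coefficient vanishes.
  have hind : AlgebraicIndependent (Subalgebra.algebraicClosure R₀ L)
      (fun w : (B \ s : Set V) => v w) := by
    have := AlgebraicIndependent.adjoin_of_disjoint (x := fun w : B => v w) hB
      (s := {w | w.1 ∈ s}) (t := {w | w.1 ∉ s}) (by
        rw [Set.disjoint_left]; intro w h h'; exact h' h)
    have himg : (fun w : B => v w) '' {w | w.1 ∈ s} = v '' s := by
      ext y
      constructor
      · rintro ⟨w, hw, rfl⟩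
        exact ⟨w, hw, rfl⟩
      · rintro ⟨w, hw, rfl⟩
        exact ⟨⟨w, hsB hw⟩, hw, rfl⟩
    rw [himg] at this
    have := this.comp (fun w : (B \ s : Set V) =>
      (⟨⟨w, w.2.1⟩, w.2.2⟩ : {w : B | w.1 ∉ s})) (fun i j hij => Subtype.ext (by simpa using hij))
    exact this.subalgebraAlgebraicClosure
  let ψ₁ : MvPolynomial T K →+* Subalgebra.algebraicClosure R₀ L :=
    (ψ₀ : MvPolynomial T K →+* L).codRestrict (Subalgebra.algebraicClosure R₀ L).toSubring hψ
  let Ψ : MvPolynomial (B \ s : Set V) (MvPolynomial T K) →+* MvPolynomial V K :=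
    eval₂Hom (rename (Subtype.val : T → V) : MvPolynomial T K →ₐ[K] MvPolynomial V K) fun w => X w
  have hΨ : ∀ F, aeval v (Ψ F) = aeval (fun w : (B \ s : Set V) => v w) (map ψ₁ F) := by
    intro F
    induction F using MvPolynomial.induction_on with
    | C a =>
      simp only [Ψ, coe_eval₂Hom, eval₂_C, RingHom.coe_coe, aeval_rename, map_C, aeval_C]
      rfl
    | add f g hf hg => simp only [map_add, hf, hg]
    | mul_X f w hf =>
      rw [map_mul, map_mul, hf, map_mul, map_mul, map_X, aeval_X]
      simp [Ψ]
  -- Hilbert's basis theorem in the finitely many variables T.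
  have hfg : (RingHom.ker ψ₀).FG := IsNoetherian.noetherian _
  obtain ⟨E, hE⟩ := hfg
  refine ⟨E.image (rename (Subtype.val : T → V)), ?_, ?_⟩
  · intro g hg
    obtain ⟨e, he, rfl⟩ := Finset.mem_image.mp hg
    have : e ∈ RingHom.ker ψ₀ := hE ▸ Ideal.subset_span he
    rw [aeval_rename]
    exact this
  · intro f hf h0
    have hrange : f ∈ Ψ.range := by
      clear h0
      rw [supported_eq_adjoin_X] at hf
      induction hf using Algebra.adjoin_induction with
      | mem x hx =>
        obtain ⟨w, hw, rfl⟩ := hx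
        by_cases hwT : w ∈ T
        · exact ⟨C (X ⟨w, hwT⟩), by simp [Ψ]⟩
        · have : w ∈ B \ s := by
            simp only [T, Set.mem_union, not_or] at hwT
            exact ⟨hUB (hw.resolve_left hwT.1), hwT.2⟩
          exact ⟨X ⟨w, this⟩, by simp [Ψ]⟩
      | algebraMap r => exact ⟨C (C r), by simp [Ψ]⟩
      | add x y _ _ hx hy => exact add_mem hx hy
      | mul x y _ _ hx hy => exact mul_mem hx hy
    obtain ⟨F, rfl⟩ := hrange
    rw [hΨ] at h0
    have hF0 : map ψ₁ F = 0 := by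
      apply hind
      rw [h0, map_zero]
    have hF : F ∈ Ideal.map C (RingHom.ker ψ₀) := by
      rw [mem_map_C_iff]
      intro e
      have := congrArg (fun P => ((coeff e P : Subalgebra.algebraicClosure R₀ L) : L)) hF0
      simp only [coeff_map, coeff_zero] at this
      exact this
    have := Ideal.mem_map_of_mem Ψ hF
    rw [Ideal.map_map, ← hE, Ideal.map_span] at this
    convert this using 3
    ext g
    simp [Ψ]

end


/-! ### Ranking of derivatives and Dickson's lemma -/

/-- The rank of a derivative: derivatives are ordered first by the differential indeterminate and
then lexicographically by the exponents. -/
def rank {N m : ℕ} (w : Fin m × (Fin N → ℕ)) : Fin m ×ₗ Lex (Fin N → ℕ) :=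
  toLex (w.1, toLex w.2)

/-- The action of `∂ᵢ` on the indices of derivatives. -/
def shift {N : ℕ} {ι : Type*} (i : Fin N) (w : ι × (Fin N → ℕ)) : ι × (Fin N → ℕ) :=
  (w.1, w.2 + Pi.single i 1)

section Rank

variable {N m : ℕ}

lemma rank_injective : Function.Injective (rank : Fin m × (Fin N → ℕ) → _) := by
  intro w w' h
  have := toLex.injective h
  exact Prod.ext (congrArg Prod.fst this) (toLex.injective (congrArg Prod.snd this))

lemma rank_lt_iff {w w' : Fin m × (Fin N → ℕ)} :
    rank w < rank w' ↔ w.1 < w'.1 ∨ w.1 = w'.1 ∧ toLex w.2 < toLex w'.2 :=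
  Prod.Lex.toLex_lt_toLex

lemma rank_lt_rank_shift (i : Fin N) (w : Fin m × (Fin N → ℕ)) : rank w < rank (shift i w) := by
  rw [rank_lt_iff]
  refine Or.inr ⟨rfl, ?_⟩
  apply Pi.toLex_strictMono
  exact lt_add_of_pos_right _ (by simp [Pi.single_pos])

lemma rank_shift_lt_rank_shift (i : Fin N) {w w' : Fin m × (Fin N → ℕ)} (h : rank w < rank w') :
    rank (shift i w) < rank (shift i w') := by
  rw [rank_lt_iff] at h ⊢
  rcases h with h | ⟨h1, h2⟩
  · exact Or.inl h
  · refine Or.inr ⟨h1, ?_⟩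
    exact add_lt_add_left h2 (toLex (Pi.single i 1 : Fin N → ℕ))

/-- Dickson's lemma: the minimal elements form an antichain in a well-quasi-order. -/
lemma exists_finite_minimal (s : Set (Fin N → ℕ)) :
    ∃ t ⊆ s, t.Finite ∧ ∀ e ∈ s, ∃ d ∈ t, d ≤ e := by
  refine ⟨{d | Minimal (· ∈ s) d}, fun d hd => hd.1, ?_, ?_⟩
  · exact WellQuasiOrderedLE.finite_of_isAntichain (setOfPred_minimal_antichain _)
  · intro e he
    obtain ⟨d, hde, hd⟩ := (Set.isPWO_of_wellQuasiOrderedLE s).exists_le_minimal he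
    exact ⟨d, hd, hde⟩

lemma exists_finite_minimal_derivatives (s : Set (Fin m × (Fin N → ℕ))) :
    ∃ t ⊆ s, t.Finite ∧ ∀ w ∈ s, ∃ e, (w.1, e) ∈ t ∧ e ≤ w.2 := by
  choose t hts ht hmin using fun j : Fin m => exists_finite_minimal {e | (j, e) ∈ s}
  refine ⟨⋃ j, (fun e => (j, e)) '' t j, ?_, Set.finite_iUnion fun j => (ht j).image _, ?_⟩
  · intro w hw
    obtain ⟨j, e, he, rfl⟩ := Set.mem_iUnion.mp hw
    exact hts j he
  · intro w hw
    obtain ⟨e, he, hle⟩ := hmin w.1 w.2 hw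
    exact ⟨e, Set.mem_iUnion.mpr ⟨w.1, e, he, rfl⟩, hle⟩

end Rank

/-! ### Membership up to a power of h and modulo an ideal -/

section Saturation

variable {R₀ R : Type*} [CommRing R₀] [CommRing R] [Algebra R₀ R]

/-- The elements that belong to `A` modulo `J` after multiplication by a power of `h`. -/
def saturation (A : Subalgebra R₀ R) (J : Ideal R) {h : R} (hh : h ∈ A) : Subalgebra R₀ R where
  carrier := {f | ∃ r : ℕ, ∃ a ∈ A, h ^ r * f - a ∈ J}
  algebraMap_mem' c := ⟨0, algebraMap R₀ R c, A.algebraMap_mem c, by simp⟩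
  add_mem' := by
    rintro f g ⟨r, a, ha, hf⟩ ⟨q, b, hb, hg⟩
    refine ⟨r + q, h ^ q * a + h ^ r * b,
      add_mem (mul_mem (pow_mem hh _) ha) (mul_mem (pow_mem hh _) hb), ?_⟩
    have : h ^ (r + q) * (f + g) - (h ^ q * a + h ^ r * b) =
      h ^ q * (h ^ r * f - a) + h ^ r * (h ^ q * g - b) := by ring
    rw [this]
    exact add_mem (J.mul_mem_left _ hf) (J.mul_mem_left _ hg)
  mul_mem' := by
    rintro f g ⟨r, a, ha, hf⟩ ⟨q, b, hb, hg⟩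
    refine ⟨r + q, a * b, mul_mem ha hb, ?_⟩
    have : h ^ (r + q) * (f * g) - a * b =
      (h ^ q * g) * (h ^ r * f - a) + a * (h ^ q * g - b) := by ring
    rw [this]
    exact add_mem (J.mul_mem_left _ hf) (J.mul_mem_left _ hg)

variable {A : Subalgebra R₀ R} {J : Ideal R} {h : R} (hh : h ∈ A)

include hh in
lemma le_saturation : A ≤ saturation A J hh := fun a ha => ⟨0, a, ha, by simp⟩

include hh in
lemma mem_saturation_of_mem {f : R} (hf : f ∈ J) : f ∈ saturation A J hh :=
  ⟨0, 0, zero_mem _, by simpa using hf⟩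

lemma mem_saturation_of_mul_mem {f : R} (hf : h * f ∈ saturation A J hh) :
    f ∈ saturation A J hh := by
  obtain ⟨r, a, ha, hr⟩ := hf
  exact ⟨r + 1, a, ha, by rwa [pow_succ, mul_assoc]⟩

end Saturation

/-! ### Reduction to parametric derivatives -/

section Reduction

variable {N m : ℕ} {κ K : Type*} [Field K] [DeltaRing N K]

/-- The index of a derivative of one of the first `m` indeterminates. -/
def inlIndex {N m : ℕ} (κ : Type*) (w : Fin m × (Fin N → ℕ)) : (Fin m ⊕ κ) × (Fin N → ℕ) :=
  (Sum.inl w.1, w.2)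

/-- The derivatives of rank lower than `w`, together with all derivatives of the indeterminates
indexed by `κ`. -/
def lowerSet (κ : Type*) (w : Fin m × (Fin N → ℕ)) : Set ((Fin m ⊕ κ) × (Fin N → ℕ)) :=
  {z | ∃ γ e, z = (Sum.inr γ, e)} ∪ inlIndex κ '' {w' | rank w' < rank w}

/-- The derivatives with indices in `U`, together with the indeterminates indexed by `κ`. -/
def parametricSet (κ : Type*) (U : Set (Fin m × (Fin N → ℕ))) :
    Set ((Fin m ⊕ κ) × (Fin N → ℕ)) :=
  Set.range (fun γ => (Sum.inr γ, 0)) ∪ inlIndex κ '' U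

lemma parametricSet_subset_lowerSet {U : Set (Fin m × (Fin N → ℕ))} {w : Fin m × (Fin N → ℕ)}
    (hU : ∀ u ∈ U, rank u < rank w) : parametricSet κ U ⊆ lowerSet κ w := by
  rintro z (⟨γ, rfl⟩ | ⟨u, hu, rfl⟩)
  · exact Or.inl ⟨γ, 0, rfl⟩
  · exact Or.inr ⟨u, hU u hu, rfl⟩

lemma lowerSet_subset_shift (i : Fin N) (w : Fin m × (Fin N → ℕ)) :
    lowerSet κ w ⊆ lowerSet κ (shift i w) := by
  rintro z (hz | ⟨w', hw', rfl⟩)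
  · exact Or.inl hz
  · exact Or.inr ⟨w', lt_trans hw' (rank_lt_rank_shift i w), rfl⟩

lemma shift_mem_lowerSet (i : Fin N) {w : Fin m × (Fin N → ℕ)} :
    ∀ z ∈ lowerSet κ w, (z.1, z.2 + Pi.single i 1) ∈ lowerSet κ (shift i w) := by
  rintro z (⟨γ, e, rfl⟩ | ⟨w', hw', rfl⟩)
  · exact Or.inl ⟨γ, _, rfl⟩
  · exact Or.inr ⟨shift i w', rank_shift_lt_rank_shift i hw', rfl⟩

/-- Differentiating a relation that is linear in its leader. -/
lemma exists_derivative_relation {J : Ideal (MvPolynomial ((Fin m ⊕ κ) × (Fin N → ℕ)) K)}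
    (hJ : ∀ i, ∀ f ∈ J, polyDer i f ∈ J) {w : Fin m × (Fin N → ℕ)}
    {s t : MvPolynomial ((Fin m ⊕ κ) × (Fin N → ℕ)) K} (hs : s ∈ supported K (lowerSet κ w))
    (ht : t ∈ supported K (lowerSet κ w)) (hst : s * X (inlIndex κ w) - t ∈ J)
    (e : Fin N → ℕ) : s ∈ supported K (lowerSet κ (w.1, w.2 + e)) ∧
      ∃ r ∈ supported K (lowerSet κ (w.1, w.2 + e)),
        s * X (inlIndex κ (w.1, w.2 + e)) - r ∈ J := by
  induction e using exponent_induction with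
  | zero => exact ⟨by simpa using hs, t, by simpa using ht, by simpa using hst⟩
  | add e i ih =>
    obtain ⟨hse, r, hr, hrJ⟩ := ih
    have hw : (w.1, w.2 + (e + Pi.single i 1)) = shift i (w.1, w.2 + e) := by
      simp [shift, add_assoc]
    rw [hw]
    set w' := (w.1, w.2 + e)
    have hX : (X (inlIndex κ w') : MvPolynomial _ K) ∈ supported K (lowerSet κ (shift i w')) :=
      X_mem_supported.mpr (Or.inr ⟨w', rank_lt_rank_shift i w', rfl⟩)
    have hD : ∀ f ∈ supported K (lowerSet κ w'), polyDer i f ∈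
        supported K (lowerSet κ (shift i w')) := fun f hf =>
      polyDer_mem_supported i (lowerSet_subset_shift i w') (shift_mem_lowerSet i) hf
    -- By Leibniz the new leader keeps the coefficient s; the term with ∂ᵢ s moves to the remainder.
    refine ⟨supported_mono (lowerSet_subset_shift i w') hse,
      polyDer i r - X (inlIndex κ w') * polyDer i s,
      sub_mem (hD r hr) (mul_mem hX (hD s hse)), ?_⟩
    have := hJ i _ hrJ
    rw [map_sub, Derivation.leibniz, polyDer_X, smul_eq_mul, smul_eq_mul] at this
    convert this using 1
    simp only [inlIndex, shift]
    ring

/-- Modulo a differential ideal containing sufficiently many relations linear in their leaders,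
and up to powers of the coefficients of the leaders, each differential polynomial is a polynomial
in the parametric derivatives. -/
theorem saturation_eq_top {J : Ideal (MvPolynomial ((Fin m ⊕ κ) × (Fin N → ℕ)) K)}
    (hJ : ∀ i, ∀ f ∈ J, polyDer i f ∈ J) (hκ : ∀ γ, ∀ e ≠ 0, X (Sum.inr γ, e) ∈ J)
    {U M : Set (Fin m × (Fin N → ℕ))} (hM : ∀ w ∉ U, ∃ e, (w.1, e) ∈ M ∧ e ≤ w.2)
    {s t : Fin m × (Fin N → ℕ) → MvPolynomial ((Fin m ⊕ κ) × (Fin N → ℕ)) K}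
    (hs : ∀ w ∈ M, s w ∈ supported K (lowerSet κ w))
    (ht : ∀ w ∈ M, t w ∈ supported K (lowerSet κ w))
    (hst : ∀ w ∈ M, s w * X (inlIndex κ w) - t w ∈ J)
    {h : MvPolynomial ((Fin m ⊕ κ) × (Fin N → ℕ)) K}
    (hh : h ∈ supported K (parametricSet κ U))
    (hdvd : ∀ w ∈ M, ∃ q ∈ supported K (parametricSet κ U), h = q * s w) :
    saturation (supported K (parametricSet κ U)) J hh = ⊤ := by
  set B := saturation (supported K (parametricSet κ U)) J hh with hB
  have hinr : ∀ γ e, (X (Sum.inr γ, e) : MvPolynomial _ K) ∈ B := by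
    intro γ e
    by_cases he : e = 0
    · subst he
      exact le_saturation hh (X_mem_supported.mpr (Or.inl ⟨γ, rfl⟩))
    · exact mem_saturation_of_mem hh (hκ γ e he)
  have hinl : ∀ w, (X (inlIndex κ w) : MvPolynomial _ K) ∈ B := by
    intro w
    induction hr : rank w using WellFoundedLT.induction generalizing w with
    | _ o ih =>
    subst hr
    by_cases hw : w ∈ U
    · exact le_saturation hh (X_mem_supported.mpr (Or.inr ⟨w, hw, rfl⟩))
    obtain ⟨e, he, hle⟩ := hM w hw
    -- Modulo J this gives s X = r with r of lower rank, and h is a multiple of s.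
    obtain ⟨-, r, hr, hrJ⟩ := exists_derivative_relation hJ (hs _ he) (ht _ he) (hst _ he)
      (w.2 - e)
    have hwe : ((w.1, e).1, (w.1, e).2 + (w.2 - e)) = w :=
      Prod.ext rfl (add_tsub_cancel_of_le hle)
    rw [hwe] at hr hrJ
    have hrB : r ∈ B := by
      refine (show supported K (lowerSet κ w) ≤ B from ?_) hr
      rw [supported_eq_adjoin_X, Algebra.adjoin_le_iff]
      rintro _ ⟨z, ⟨γ, d, rfl⟩ | ⟨w', hw', rfl⟩, rfl⟩
      · exact hinr γ d
      · exact ih _ hw' w' rfl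
    obtain ⟨q, hq, hqs⟩ := hdvd _ he
    apply mem_saturation_of_mul_mem
    have : h * X (inlIndex κ w) = q * (s (w.1, e) * X (inlIndex κ w) - r) + q * r := by
      rw [hqs]; ring
    rw [this]
    exact add_mem (mem_saturation_of_mem hh (J.mul_mem_left _ hrJ))
      (mul_mem (le_saturation hh hq) hrB)
  rw [eq_top_iff]
  intro f _
  induction f using MvPolynomial.induction_on with
  | C a => exact B.algebraMap_mem a
  | add f g hf hg => exact add_mem (hf trivial) (hg trivial)
  | mul_X f w hf =>
    refine mul_mem (hf trivial) ?_
    obtain ⟨j | γ, e⟩ := w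
    · exact hinl (j, e)
    · exact hinr γ e

end Reduction


/-! ### A finite system that controls all relations of a tuple -/

instance deltaAlgebra_self {N : ℕ} {K : Type*} [CommRing K] [DeltaRing N K] :
    DeltaAlgebra N K K := ⟨fun _ _ => rfl⟩

lemma exists_supported_of_mem_adjoin {V K L : Type*} [Field K] [Field L] [Algebra K L]
    (φ : MvPolynomial V K →ₐ[K] L) (T : Set V) {z : L}
    (hz : z ∈ IntermediateField.adjoin K ((fun t => φ (X t)) '' T)) :
    ∃ s ∈ supported K T, ∃ t ∈ supported K T, φ s ≠ 0 ∧ φ s * z = φ t := by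
  have himg : (fun t => φ (X t)) '' T = φ '' (X '' T) := by rw [Set.image_image]
  rw [himg, IntermediateField.mem_adjoin_iff_div] at hz
  obtain ⟨r, hr, s, hs, rfl⟩ := hz
  rw [← AlgHom.map_adjoin, ← supported_eq_adjoin_X] at hr hs
  obtain ⟨r, hr, rfl⟩ := hr
  obtain ⟨s, hs, rfl⟩ := hs
  by_cases h0 : φ s = 0
  -- A quotient with zero denominator is 0 by convention.
  · exact ⟨1, one_mem _, 0, zero_mem _, by simp, by simp [h0]⟩
  · exact ⟨s, hs, r, hr, h0, mul_div_cancel₀ _ h0⟩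

lemma exists_finset_of_mem_adjoin_union {K L : Type*} [Field K] [Field L] [Algebra K L]
    {C Y : Set L} {z : L} (hz : z ∈ IntermediateField.adjoin K (C ∪ Y)) :
    ∃ G : Finset L, (G : Set L) ⊆ C ∧ z ∈ IntermediateField.adjoin K ((G : Set L) ∪ Y) := by
  classical
  obtain ⟨T, hT, hz⟩ := IntermediateField.exists_finset_of_mem_adjoin hz
  refine ⟨T.filter (· ∈ C), fun x hx => (Finset.mem_filter.mp hx).2,
    IntermediateField.adjoin.mono _ _ _ ?_ hz⟩
  intro x hx
  by_cases hxC : x ∈ C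
  · exact Or.inl (Finset.mem_filter.mpr ⟨hx, hxC⟩)
  · exact Or.inr ((hT hx).resolve_left hxC)

section

variable {N m : ℕ} {K L : Type*} [Field K] [DeltaRing N K] [Field L] [DeltaRing N L] [Algebra K L]

/-- The subfield of `L` generated over `K` by the constants and the derivatives of `a` of rank
lower than `w`. -/
def fieldBelow (K : Type*) {L : Type*} [Field K] [Field L] [DeltaRing N L] [Algebra K L]
    (a : Fin m → L) (w : Fin m × (Fin N → ℕ)) : IntermediateField K L :=
  IntermediateField.adjoin K
    (constants N L ∪ (fun w => theta w.2 (a w.1)) '' {w' | rank w' < rank w})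

/-- The parametric derivatives of `a`: those that are not rational over the constants in
derivatives of lower rank. -/
def parametric (K : Type*) {L : Type*} [Field K] [Field L] [DeltaRing N L] [Algebra K L]
    (a : Fin m → L) : Set (Fin m × (Fin N → ℕ)) :=
  {w | theta w.2 (a w.1) ∉ fieldBelow K a w}

omit [DeltaRing N K] in
-- Nonparametric generators are successively replaced by ones of lower rank; this ends because ranks
-- are well-ordered.
lemma fieldBelow_le_adjoin_parametric (a : Fin m → L) (w : Fin m × (Fin N → ℕ)) :
    fieldBelow K a w ≤ IntermediateField.adjoin K (constants N L ∪
      (fun w => theta w.2 (a w.1)) '' {u | u ∈ parametric K a ∧ rank u < rank w}) := by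
  induction hr : rank w using WellFoundedLT.induction generalizing w with
  | _ o ih =>
  subst hr
  rw [fieldBelow, IntermediateField.adjoin_le_iff]
  rintro z (hz | ⟨w', hw', rfl⟩)
  · exact IntermediateField.subset_adjoin _ _ (Or.inl hz)
  · by_cases hp : w' ∈ parametric K a
    · exact IntermediateField.subset_adjoin _ _ (Or.inr ⟨w', ⟨hp, hw'⟩, rfl⟩)
    · have hmem : theta w'.2 (a w'.1) ∈ fieldBelow K a w' := not_not.mp hp
      refine IntermediateField.adjoin.mono _ _ _ ?_ (ih _ hw' w' rfl hmem)
      apply Set.union_subset_union_right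
      apply Set.image_mono
      exact fun u hu => ⟨hu.1, hu.2.trans hw'⟩

lemma algebraicIndepOn_parametric [DeltaAlgebra N K L] {p : ℕ} (hp : p.Prime) [CharP K p]
    [CharP L p] (hK : ∀ c ∈ constants N K, ∃ d, d ^ p = c) (a : Fin m → L) :
    AlgebraicIndepOn K (fun w : Fin m × (Fin N → ℕ) => theta w.2 (a w.1)) (parametric K a) := by
  refine algebraicIndependent_of_notMem_adjoin (N := N) (σ := parametric K a) hp hK
    (fun u => rank u.1) (fun u u' h => Subtype.ext (rank_injective h))
    (fun u => theta u.1.2 (a u.1.1)) fun u hu => ?_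
  have hle : IntermediateField.adjoin K (constants N L ∪
      (fun u : parametric K a => theta u.1.2 (a u.1.1)) '' {w | rank w.1 < rank u.1}) ≤
      fieldBelow K a u.1 := by
    apply IntermediateField.adjoin.mono
    apply Set.union_subset_union_right
    rintro _ ⟨w, hw, rfl⟩
    exact ⟨w.1, hw, rfl⟩
  exact u.2 (hle hu)

/-- The relations of a tuple in a differential field, possibly after adding finitely many constants
to it, are determined over `K` by finitely many of them and one inequation. -/
theorem exists_finite_system [DeltaAlgebra N K L] {p : ℕ} (hp : p.Prime) [CharP K p]
    [CharP L p] (hK : ∀ c ∈ constants N K, ∃ d, d ^ p = c) (a : Fin m → L) :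
    ∃ (Γ : Finset L) (P : Finset (MvPolynomial ((Fin m ⊕ Γ) × (Fin N → ℕ)) K))
      (h : MvPolynomial ((Fin m ⊕ Γ) × (Fin N → ℕ)) K),
      (∀ f ∈ P, deltaEval N K (Sum.elim a Subtype.val) f = 0) ∧
      deltaEval N K (Sum.elim a Subtype.val) h ≠ 0 ∧
      ∀ c : Fin m ⊕ Γ → K, (∀ f ∈ P, deltaEval N K c f = 0) → deltaEval N K c h ≠ 0 →
        ∀ f, deltaEval N K (Sum.elim a Subtype.val) f = 0 → deltaEval N K c f = 0 := by
  classical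
  set U : Set (Fin m × (Fin N → ℕ)) := parametric K a with hU
  obtain ⟨M, hMU, hMfin, hM⟩ := exists_finite_minimal_derivatives Uᶜ
  have hex : ∀ w : Fin m × (Fin N → ℕ), ∃ G : Finset L, (G : Set L) ⊆ constants N L ∧
      (w ∈ M → theta w.2 (a w.1) ∈ IntermediateField.adjoin K ((G : Set L) ∪
        (fun w => theta w.2 (a w.1)) '' {u | u ∈ U ∧ rank u < rank w})) := by
    intro w
    by_cases hw : w ∈ M
    · have hmem : theta w.2 (a w.1) ∈ fieldBelow K a w := not_not.mp (hMU hw)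
      obtain ⟨G, hG, hz⟩ :=
        exists_finset_of_mem_adjoin_union (fieldBelow_le_adjoin_parametric a w hmem)
      exact ⟨G, hG, fun _ => hz⟩
    · exact ⟨∅, by simp, fun h => absurd h hw⟩
  choose G hGC hG using hex
  -- The constants needed to express the finitely many derivatives in M.
  set Γ : Finset L := hMfin.toFinset.biUnion G with hΓ
  have hΓC : ∀ γ ∈ Γ, γ ∈ constants N L := by
    intro γ hγ
    obtain ⟨w, _, hw⟩ := Finset.mem_biUnion.mp hγ
    exact hGC w hw
  set y : Fin m ⊕ Γ → L := Sum.elim a Subtype.val with hy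
  set φ := deltaEval N K y with hφ
  have hrel : ∀ w : Fin m × (Fin N → ℕ),
      ∃ s t : MvPolynomial ((Fin m ⊕ Γ) × (Fin N → ℕ)) K, w ∈ M →
        s ∈ supported K (parametricSet Γ {u | u ∈ U ∧ rank u < rank w}) ∧
        t ∈ supported K (parametricSet Γ {u | u ∈ U ∧ rank u < rank w}) ∧
        φ s ≠ 0 ∧ φ (s * X (inlIndex Γ w) - t) = 0 := by
    intro w
    by_cases hw : w ∈ M
    · obtain ⟨s, hs, t, ht, hs0, hst⟩ := exists_supported_of_mem_adjoin φ
        (parametricSet Γ {u | u ∈ U ∧ rank u < rank w}) (z := theta w.2 (a w.1)) (by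
          refine IntermediateField.adjoin.mono _ _ _ ?_ (hG w hw)
          rintro z (hz | ⟨u, hu, rfl⟩)
          · have hzΓ : z ∈ Γ := Finset.mem_biUnion.mpr ⟨w, hMfin.mem_toFinset.mpr hw, hz⟩
            exact ⟨(Sum.inr ⟨z, hzΓ⟩, 0), Or.inl ⟨_, rfl⟩, by simp [hφ, hy]⟩
          · exact ⟨inlIndex Γ u, Or.inr ⟨u, hu, rfl⟩, by simp [hφ, hy, inlIndex]⟩)
      refine ⟨s, t, fun _ => ⟨hs, ht, hs0, ?_⟩⟩
      rw [map_sub, map_mul, sub_eq_zero, ← hst]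
      simp [hφ, hy, inlIndex]
    · exact ⟨0, 0, fun h => absurd h hw⟩
  choose s t hst using hrel
  set h : MvPolynomial ((Fin m ⊕ Γ) × (Fin N → ℕ)) K := ∏ w ∈ hMfin.toFinset, s w with hh
  have hsub : ∀ w, parametricSet Γ {u | u ∈ U ∧ rank u < rank w} ⊆ parametricSet Γ U := fun w =>
    Set.union_subset_union_right _ (Set.image_mono fun u hu => hu.1)
  have hsA : ∀ w ∈ hMfin.toFinset, s w ∈ supported K (parametricSet Γ U) := fun w hw =>
    supported_mono (hsub w) (hst w (hMfin.mem_toFinset.mp hw)).1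
  have hhA : h ∈ supported K (parametricSet Γ U) := prod_mem hsA
  have hind : AlgebraicIndepOn K
      (fun z : (Fin m ⊕ Γ) × (Fin N → ℕ) => theta z.2 (y z.1)) (inlIndex Γ '' U) := by
    have h1 := algebraicIndepOn_parametric hp hK a
    choose k hkU hk using fun z : inlIndex Γ '' U => z.2
    have := h1.comp (fun z => (⟨k z, hkU z⟩ : parametric K a)) (by
      intro z z' hz
      apply Subtype.ext
      rw [← hk z, ← hk z']
      exact congrArg (inlIndex Γ) (congrArg Subtype.val hz))
    convert this using 1
    funext z
    conv_lhs => rw [← hk z]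
    rfl
  obtain ⟨E, hE0, hE⟩ := exists_finset_relations (K := K)
    (fun z : (Fin m ⊕ Γ) × (Fin N → ℕ) => theta z.2 (y z.1))
    (Set.finite_range fun γ : Γ => ((Sum.inr γ, 0) : (Fin m ⊕ Γ) × (Fin N → ℕ))) hind
  -- The equations say that Γ is constant, express the derivatives in M, and generate the relations
  -- among Γ and the parametric derivatives.
  obtain ⟨P, hP⟩ : ∃ P : Finset (MvPolynomial ((Fin m ⊕ Γ) × (Fin N → ℕ)) K), ∀ f, f ∈ P ↔
      ((∃ γ i, f = X (Sum.inr γ, Pi.single i 1)) ∨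
        (∃ w ∈ M, f = s w * X (inlIndex Γ w) - t w)) ∨ f ∈ E := by
    have h1 : {f : MvPolynomial ((Fin m ⊕ Γ) × (Fin N → ℕ)) K |
        ∃ γ i, f = X (Sum.inr γ, Pi.single i 1)}.Finite := by
      refine (Set.finite_range fun q : Γ × Fin N => (X (Sum.inr q.1, Pi.single q.2 1) :
        MvPolynomial ((Fin m ⊕ Γ) × (Fin N → ℕ)) K)).subset ?_
      rintro _ ⟨γ, i, rfl⟩
      exact ⟨(γ, i), rfl⟩
    have h2 : {f | ∃ w ∈ M, f = s w * X (inlIndex Γ w) - t w}.Finite := by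
      refine (hMfin.image fun w => s w * X (inlIndex Γ w) - t w).subset ?_
      rintro _ ⟨w, hw, rfl⟩
      exact ⟨w, hw, rfl⟩
    exact ⟨((h1.union h2).union E.finite_toSet).toFinset, fun f => Set.Finite.mem_toFinset _⟩
  refine ⟨Γ, P, h, ?_, ?_, ?_⟩
  · intro f hf
    rcases (hP f).mp hf with (⟨γ, i, rfl⟩ | ⟨w, hw, rfl⟩) | hf
    · rw [deltaEval_X]
      have := theta_add_single 0 i (y (Sum.inr γ))
      rw [zero_add, theta_zero] at this
      exact this.trans (hΓC γ.1 γ.2 i)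
    · exact (hst w hw).2.2.2
    · exact hE0 f hf
  · rw [hh, map_prod]
    exact Finset.prod_ne_zero_iff.mpr fun w hw => (hst w (hMfin.mem_toFinset.mp hw)).2.2.1
  · intro c hc hch f hf
    have hcE : ∀ f ∈ E, deltaEval N K c f = 0 := fun f hf => hc f ((hP f).mpr (Or.inr hf))
    have hcM : ∀ w ∈ M, deltaEval N K c (s w * X (inlIndex Γ w) - t w) = 0 := fun w hw =>
      hc _ ((hP _).mpr (Or.inl (Or.inr ⟨w, hw, rfl⟩)))
    have hcΓ : ∀ γ : Γ, ∀ i : Fin N, DeltaRing.der i (c (Sum.inr γ)) = 0 := by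
      intro γ i
      have h1 := hc (X (Sum.inr γ, Pi.single i 1)) ((hP _).mpr (Or.inl (Or.inl ⟨γ, i, rfl⟩)))
      have h2 := theta_add_single 0 i (c (Sum.inr γ))
      rw [zero_add, theta_zero] at h2
      rw [deltaEval_X] at h1
      exact h2.symm.trans h1
    -- Congruences modulo this differential ideal hold both at the tuple in L and at c.
    let J : Ideal (MvPolynomial ((Fin m ⊕ Γ) × (Fin N → ℕ)) K) :=
      RingHom.ker φ ⊓ RingHom.ker (deltaEval N K c)
    have hJ : ∀ i, ∀ f ∈ J, polyDer i f ∈ J := by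
      rintro i f ⟨h1, h2⟩
      have h1' : φ f = 0 := h1
      have h2' : deltaEval N K c f = 0 := h2
      refine ⟨?_, ?_⟩
      · change deltaEval N K y (polyDer i f) = 0
        rw [deltaEval_polyDer, h1', map_zero]
      · change deltaEval N K c (polyDer i f) = 0
        rw [deltaEval_polyDer, h2', map_zero]
    have hlow : ∀ w, supported K (parametricSet Γ {u | u ∈ U ∧ rank u < rank w}) ≤
        supported K (lowerSet Γ w) := fun w =>
      supported_mono (parametricSet_subset_lowerSet fun u hu => hu.2)
    have htop := saturation_eq_top (κ := Γ) (U := U) (M := M) (s := s) (t := t) (h := h) hJ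
      (by
        intro γ e he
        refine ⟨?_, ?_⟩
        · change deltaEval N K y _ = 0
          rw [deltaEval_X]
          exact theta_of_forall_der_eq_zero (hΓC γ.1 γ.2) he
        · change deltaEval N K c _ = 0
          rw [deltaEval_X]
          exact theta_of_forall_der_eq_zero (hcΓ γ) he)
      (fun w hw => hM w hw)
      (fun w hw => hlow w (hst w hw).1) (fun w hw => hlow w (hst w hw).2.1)
      (fun w hw => ⟨(hst w hw).2.2.2, hcM w hw⟩) hhA
      (by
        intro w hw
        have hw' := hMfin.mem_toFinset.mpr hw
        refine ⟨∏ w ∈ hMfin.toFinset.erase w, s w,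
          prod_mem fun v hv => hsA v (Finset.mem_of_mem_erase hv), ?_⟩
        rw [hh, Finset.prod_erase_mul _ _ hw'])
    -- Since f vanishes in L, so does α; then E forces α to vanish at c, and h is nonzero there.
    obtain ⟨r, α, hα, hαJ⟩ := (htop ▸ Algebra.mem_top : f ∈ saturation _ J hhA)
    have h1 : φ (h ^ r * f - α) = 0 := hαJ.1
    have h2 : deltaEval N K c (h ^ r * f - α) = 0 := hαJ.2
    have hα0 : φ α = 0 := by
      rw [map_sub, map_mul, show φ f = 0 from hf, mul_zero, zero_sub, neg_eq_zero] at h1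
      exact h1
    have hαc : deltaEval N K c α = 0 := by
      have hspan : α ∈ Ideal.span (E : Set (MvPolynomial ((Fin m ⊕ Γ) × (Fin N → ℕ)) K)) :=
        hE α hα hα0
      have hle : Ideal.span (E : Set (MvPolynomial ((Fin m ⊕ Γ) × (Fin N → ℕ)) K)) ≤
          RingHom.ker (deltaEval N K c) := Ideal.span_le.mpr fun f hf => hcE f hf
      exact hle hspan
    rw [map_sub, hαc, sub_zero, map_mul, map_pow] at h2
    exact (mul_eq_zero.mp h2).resolve_left (pow_ne_zero _ hch)

end

/-! ### Points of differentially finitely generated domains -/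

/-- The defining property of a differentially closed field for systems in indeterminates indexed
by an arbitrary finite type. -/
lemma IsDeltaClosed.exists_solution {N : ℕ} {K : Type u} [Field K] [DeltaRing N K]
    (hK : IsDeltaClosed N K) {ι : Type v} [Finite ι] {L : Type u} [Field L] [DeltaRing N L]
    [Algebra K L] [DeltaAlgebra N K L] (y : ι → L)
    (P Q : Finset (MvPolynomial (ι × (Fin N → ℕ)) K)) (hP : ∀ f ∈ P, deltaEval N K y f = 0)
    (hQ : ∀ f ∈ Q, deltaEval N K y f ≠ 0) :
    ∃ c : ι → K, (∀ f ∈ P, deltaEval N K c f = 0) ∧ ∀ f ∈ Q, deltaEval N K c f ≠ 0 := by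
  classical
  obtain ⟨n, ⟨e⟩⟩ := Finite.exists_equiv_fin ι
  have key : ∀ {S : Type u} [Field S] [DeltaRing N S] [Algebra K S] (z : Fin n → S)
      (f : MvPolynomial (ι × (Fin N → ℕ)) K),
      DeltaPoly.evalAt z (rename (Prod.map e id) f) = deltaEval N K (z ∘ e) f := by
    intro S _ _ _ z f
    rw [DeltaPoly.evalAt, aeval_rename]
    rfl
  obtain ⟨c, hcP, hcQ⟩ := hK n (P.image (rename (Prod.map e id))) (Q.image (rename (Prod.map e id)))
    ⟨L, inferInstance, inferInstance, inferInstance, inferInstance, y ∘ e.symm, by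
      intro f hf
      obtain ⟨g, hg, rfl⟩ := Finset.mem_image.mp hf
      rw [key, Function.comp_assoc, e.symm_comp_self]
      exact hP g hg, by
      intro f hf
      obtain ⟨g, hg, rfl⟩ := Finset.mem_image.mp hf
      rw [key, Function.comp_assoc, e.symm_comp_self]
      exact hQ g hg⟩
  refine ⟨c ∘ e, fun f hf => ?_, fun f hf => ?_⟩
  · rw [← key]
    exact hcP _ (Finset.mem_image_of_mem _ hf)
  · rw [← key]
    exact hcQ _ (Finset.mem_image_of_mem _ hf)

/-- Finite differential generation, in terms of evaluation of differential polynomials. -/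
lemma IsDeltaFG.exists_surjective {N : ℕ} {K S : Type*} [CommRing K] [DeltaRing N K] [CommRing S]
    [DeltaRing N S] [Algebra K S] [DeltaAlgebra N K S] (hS : IsDeltaFG N K S) :
    ∃ (m : ℕ) (a : Fin m → S), Function.Surjective (deltaEval N K a) := by
  obtain ⟨A, hA⟩ := hS
  refine ⟨A.card, fun i => (A.equivFin.symm i : S), ?_⟩
  rw [← AlgHom.range_eq_top]
  apply hA
  · intro x hx
    exact ⟨X (A.equivFin ⟨x, hx⟩, 0), by simp⟩
  · rintro i _ ⟨f, rfl⟩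
    exact ⟨polyDer i f, deltaEval_polyDer _ i f⟩

/-- A point of a differential algebra over a differentially closed field that avoids a given
nonzero element, in terms of a generating tuple. -/
theorem exists_point {N p : ℕ} (hp : p.Prime) {K : Type u} [Field K] [CharP K p] [DeltaRing N K]
    (hK : IsDeltaClosed N K) {L : Type u} [Field L] [DeltaRing N L] [Algebra K L]
    [DeltaAlgebra N K L] {m : ℕ} (a : Fin m → L) (b : MvPolynomial (Fin m × (Fin N → ℕ)) K)
    (hb : deltaEval N K a b ≠ 0) :
    ∃ c : Fin m → K, (∀ f, deltaEval N K a f = 0 → deltaEval N K c f = 0) ∧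
      deltaEval N K c b ≠ 0 := by
  classical
  have : CharP L p := charP_of_injective_algebraMap (algebraMap K L).injective p
  obtain ⟨Γ, P, h, hP, hh, H⟩ := exists_finite_system hp
    (fun c hc => hK.exists_pow_eq hp hc) a
  have key : ∀ {S : Type u} [Field S] [DeltaRing N S] [Algebra K S] (z : Fin m ⊕ Γ → S)
      (f : MvPolynomial (Fin m × (Fin N → ℕ)) K),
      deltaEval N K z (rename (Prod.map Sum.inl id) f) = deltaEval N K (z ∘ Sum.inl) f := by
    intro S _ _ _ z f
    rw [deltaEval, aeval_rename]
    rfl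
  obtain ⟨c, hcP, hcQ⟩ := hK.exists_solution (Sum.elim a Subtype.val) P
    {h, rename (Prod.map Sum.inl id) b} hP (by
      intro f hf
      rcases Finset.mem_insert.mp hf with rfl | hf
      · exact hh
      · rw [Finset.mem_singleton.mp hf, key]
        exact hb)
  refine ⟨c ∘ Sum.inl, fun f hf => ?_, ?_⟩
  · rw [← key]
    apply H c hcP (hcQ _ (Finset.mem_insert_self _ _))
    rw [key]
    exact hf
  · rw [← key]
    exact hcQ _ (Finset.mem_insert_of_mem (Finset.mem_singleton_self _))

lemma map_theta {N : ℕ} {S T : Type*} [CommRing S] [CommRing T] [DeltaRing N S] [DeltaRing N T]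
    (g : S →+* T) (hg : ∀ (i : Fin N) s, g (DeltaRing.der i s) = DeltaRing.der i (g s))
    (e : Fin N → ℕ) (s : S) : g (theta e s) = theta e (g s) := by
  induction e using exponent_induction with
  | zero => simp
  | add e i ih => rw [theta_add_single, theta_add_single, hg, ih]

lemma deltaEval_comp {N : ℕ} {ι K S T : Type*} [CommRing K] [CommRing S] [CommRing T]
    [DeltaRing N S] [DeltaRing N T] [Algebra K S] [Algebra K T] (g : S →ₐ[K] T)
    (hg : ∀ (i : Fin N) s, g (DeltaRing.der i s) = DeltaRing.der i (g s)) (a : ι → S)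
    (f : MvPolynomial (ι × (Fin N → ℕ)) K) :
    deltaEval N K (g ∘ a) f = g (deltaEval N K a f) := by
  have : deltaEval N K (g ∘ a) = g.comp (deltaEval N K a) := by
    apply MvPolynomial.algHom_ext
    intro w
    simp only [deltaEval_X, AlgHom.comp_apply, Function.comp_apply]
    exact (map_theta (g : S →+* T) hg _ _).symm
  rw [this, AlgHom.comp_apply]

/-- A point of a differentially finitely generated domain over a differentially closed field, in
terms of a generating tuple. -/
theorem exists_point_of_surjective {N p : ℕ} (hp : p.Prime) {K : Type u} [Field K] [CharP K p]
    [DeltaRing N K] (hK : IsDeltaClosed N K) {S : Type v} [CommRing S] [IsDomain S]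
    [DeltaRing N S] [Algebra K S] [DeltaAlgebra N K S] {m : ℕ} (a : Fin m → S)
    (ha : Function.Surjective (deltaEval N K a)) (b : MvPolynomial (Fin m × (Fin N → ℕ)) K)
    (hb : deltaEval N K a b ≠ 0) :
    ∃ c : Fin m → K, (∀ f, deltaEval N K a f = 0 → deltaEval N K c f = 0) ∧
      deltaEval N K c b ≠ 0 := by
  let e := Ideal.quotientKerAlgEquivOfSurjective ha
  -- A copy of S in the universe of K, as `IsDeltaClosed` requires of extensions.
  let Q := MvPolynomial (Fin m × (Fin N → ℕ)) K ⧸ RingHom.ker (deltaEval N K a)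
  let L := FractionRing Q
  have : IsDomain Q := e.toMulEquiv.isDomain S
  let _ : DeltaRing N Q := DeltaRing.ofEquiv e.toRingEquiv
  have he : ∀ (i : Fin N) s, e.symm (DeltaRing.der i s) = DeltaRing.der i (e.symm s) := by
    intro i s
    change _ = e.symm (DeltaRing.der i (e (e.symm s)))
    rw [e.apply_symm_apply]
  have : DeltaAlgebra N K Q := by
    refine ⟨fun i r => ?_⟩
    rw [← e.symm.commutes, ← he, DeltaAlgebra.der_algebraMap, e.symm.commutes]
  let _ : DeltaRing N L := fractionDelta N Q L
  have : DeltaAlgebra N K L := deltaAlgebra_fraction (S := Q) (L := L)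
  let g : S →ₐ[K] L := (IsScalarTower.toAlgHom K Q L).comp e.symm
  have hg : ∀ (i : Fin N) s, g (DeltaRing.der i s) = DeltaRing.der i (g s) := by
    intro i s
    change algebraMap Q L (e.symm _) = _
    rw [he]
    exact (fractionDer_algebraMap _ _).symm
  have hinj : Function.Injective g :=
    (IsFractionRing.injective Q L).comp e.symm.injective
  obtain ⟨c, hc, hcb⟩ := exists_point hp hK (L := L) (g ∘ a) b (by
    rw [deltaEval_comp g hg]
    exact (map_ne_zero_iff g hinj).mpr hb)
  refine ⟨c, fun f hf => hc f ?_, hcb⟩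
  rw [deltaEval_comp g hg, hf, map_zero]

end DeltaAlg

theorem theorem6p2 (N p : ℕ) (hp : p.Prime)
    (K : Type u) [Field K] [CharP K p] [DeltaAlg.DeltaRing N K]
    (hK : DeltaAlg.IsDeltaClosed N K)
    (S : Type v) [CommRing S] [IsDomain S] [DeltaAlg.DeltaRing N S]
    [Algebra K S] [DeltaAlg.DeltaAlgebra N K S]
    (hS : DeltaAlg.IsDeltaFG N K S)
    (b : S) (hb : b ≠ 0) :
    ∃ ψ : S →ₐ[K] K,
      (∀ (i : Fin N) (s : S),
        ψ (DeltaAlg.DeltaRing.der i s) = DeltaAlg.DeltaRing.der i (ψ s)) ∧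
      ψ b ≠ 0 := by
  obtain ⟨m, a, ha⟩ := hS.exists_surjective
  obtain ⟨b, rfl⟩ := ha b
  obtain ⟨c, hc, hcb⟩ := DeltaAlg.exists_point_of_surjective hp hK a ha b hb
  -- Sends the value at a to the value at c; both evaluations commute with the derivations, hence so
  -- does ψ.
  let ψ : S →ₐ[K] K :=
    (Ideal.Quotient.liftₐ (RingHom.ker (DeltaAlg.deltaEval N K a)) (DeltaAlg.deltaEval N K c)
      hc).comp (Ideal.quotientKerAlgEquivOfSurjective ha).symm
  have hψ : ∀ f, ψ (DeltaAlg.deltaEval N K a f) = DeltaAlg.deltaEval N K c f := by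
    intro f
    have : (Ideal.quotientKerAlgEquivOfSurjective ha).symm (DeltaAlg.deltaEval N K a f) =
        Ideal.Quotient.mk (RingHom.ker (DeltaAlg.deltaEval N K a)) f := by
      rw [AlgEquiv.symm_apply_eq]
      rfl
    change Ideal.Quotient.liftₐ (RingHom.ker (DeltaAlg.deltaEval N K a))
      (DeltaAlg.deltaEval N K c) hc ((Ideal.quotientKerAlgEquivOfSurjective ha).symm _) = _
    rw [this]
    rfl
  refine ⟨ψ, ?_, ?_⟩
  · intro i s
    obtain ⟨f, rfl⟩ := ha s
    rw [← DeltaAlg.deltaEval_polyDer, hψ, hψ, DeltaAlg.deltaEval_polyDer]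
  · rw [hψ]
    exact hcb
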